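/- **Setting.** Let $N\ge 1$, let $e_1,\dots,e_N\in\mathbb R^2$ be distinct unit vectors, and let $J_i=[0,\infty)e_i$, $J_i^*=J_i\setminus\{0\}$, $J=\bigcup_{i=1}^N J_i$. The geodesic distance on $J$ is $d(x,y)=|x-y|$ if $x,y$ lie on a common branch $J_i$ and $d(x,y)=|x|+|y|$ otherwise. Let $T>0$ and $J_T=(0,T)\times J$. Assume: * (A0) $u_0:J\to\mathbb R$ is Lipschitz continuous; * (A1) there is $\gamma>0$ and for each $i$ a function $L_i\in C^2(\mathbb R)$ with $L_i''\ge\gamma$; put $H_i(p)=\sup_{q\in\mathbb R}(pq-L_i(q))$ and $H_i^-(p)=\sup_{q\le 0}(pq-L_i(q))$. **Sub-solutions.** Let $C^1_*(J_T)$ be the set of continuous $\phi:J_T\to\mathbb R$ such that for every $i$ the function $(t,r)\mapsto\phi(t,re_i)$ is $C^1$ on $(0,T)\times[0,\infty)$; write $\phi_t$ for the time derivative and $\phi^i_x$ for the derivative along $J_i$ with respect to $r$ (one-sided at $r=0$). A function $u:[0,T)\times J\to\mathbb R$ is a sub-solution on $J_T$ of the junction problem with initial data $u_0$ if it is upper semi-continuous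 on $[0,T)\times J$, if $u(0,\cdot)\le u_0$ on $J$, and if for every $\phi\in C^1_*(J_T)$ and every $(t,x)\in J_T$ such that $u(t,x)=\phi(t,x)$ and $u\le\phi$ on the intersection of $J_T$ with some ball centred at $(t,x)$, $$\phi_t(t,x)+H_i(\phi^i_x(t,x))\le 0\quad\text{if }x\in J_i^*,\qquad \phi_t(t,0)+\max_{i=1,\dots,N}H_i^-(\phi^i_x(t,0))\le 0\quad\text{if }x=0.$$ **Value function.** Let $A(x)=\mathbb R e_i$ if $x\in J_i^*$ and $A(0)=\bigcup_i[0,\infty)e_i$. For $P=pe_i\in A(x)$ let $L(x,P)=L_i(p)$ if $x\in J_i^*$ and, for $x=0$ and $p\ge 0$, $L(0,P)=\min_j L_j(p)$. For $y,x\in J$ and $t>0$, let $\mathcal A(0,y;t,x)$ be the set of $X\in W^{1,1}([0,t];\mathbb R^2)$ with $X(\tau)\in J$ for all $\tau\in(0,t)$, $\dot X(\tau)\in A(X(\tau))$ for a.e. $\tau\in(0,t)$, $X(0)=y$ and $X(t)=x$. Define $$u_{\mathrm{oc}}(t,x)=\inf_{y\in J,\;X\in\mathcal A(0,y;t,x)}\Big\{u_0(y)+\int_0^t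 L(X(\tau),\dot X(\tau))\,d\tau\Big\},$$ where the integral takes values in $(-\infty,+\infty]$. **Proposition.** Let $u:[0,T)\times J\to\mathbb R$ be a sub-solution on $J_T$ of the junction problem with initial data $u_0$, and suppose that there exists $\sigma>0$ such that $u(t,x)\le\sigma(1+d(x,0))$ for all $(t,x)\in J_T$. Then $u\le u_{\mathrm{oc}}$ on $J_T$. -/

import Mathlib

open Set MeasureTheory

noncomputable section

namespace Junction

/-- The Euclidean plane, in which the junction is embedded. -/
abbrev Plane : Type := EuclideanSpace ℝ (Fin 2)

/-! ### The junction -/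

/-- The branch `J_i = [0, ∞) · e_i`. -/
def branch {N : ℕ} (e : Fin N → Plane) (i : Fin N) : Set Plane :=
  {x | ∃ r : ℝ, 0 ≤ r ∧ x = r • e i}

/-- The open branch `J_i^* = J_i \ {0}`. -/
def openBranch {N : ℕ} (e : Fin N → Plane) (i : Fin N) : Set Plane :=
  branch e i \ {0}

/-- The junction `J = ⋃ i, J_i`. -/
def junction {N : ℕ} (e : Fin N → Plane) : Set Plane :=
  ⋃ i, branch e i

open Classical in
/-- The geodesic distance on the junction: `|x - y|` for two points of a common branch and
`|x| + |y|` otherwise. -/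
def geodist {N : ℕ} (e : Fin N → Plane) (x y : Plane) : ℝ :=
  if ∃ i, x ∈ branch e i ∧ y ∈ branch e i then ‖x - y‖ else ‖x‖ + ‖y‖

/-! ### Lagrangians and Hamiltonians -/

/-- The Legendre-Fenchel transform `H_i(p) = sup_q (p q - ℓ(q))` of a Lagrangian `ℓ = L_i`. -/
def hamiltonian (ℓ : ℝ → ℝ) (p : ℝ) : ℝ :=
  ⨆ q : ℝ, (p * q - ℓ q)

/-- `H_i^-(p) = sup_{q ≤ 0} (p q - ℓ(q))` for `ℓ = L_i`. -/
def hamiltonianMinus (ℓ : ℝ → ℝ) (p : ℝ) : ℝ :=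
  ⨆ q : Set.Iic (0 : ℝ), (p * (q : ℝ) - ℓ (q : ℝ))

open Classical in
/-- The Lagrangian on the junction, for a velocity `P` admissible at `x`. If `x ∈ J_i^*` and
`P = p e_i` it is `L_i(p)`, where `p = ⟪e_i, P⟫` because `e_i` is a unit vector; since the open
branches are disjoint, only the term of the branch of `x` survives in the sum. If `x = 0` and
`P = p e_i` with `p ≥ 0` it is `L_0(p) = min_j L_j(p)`, where `p = ‖P‖`. -/
def lagrangian {N : ℕ} (e : Fin N → Plane) (L : Fin N → ℝ → ℝ) (x P : Plane) : ℝ :=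
  if x = 0 then ⨅ j, L j ‖P‖
  else ∑ i, if x ∈ openBranch e i then L i (inner ℝ (e i) P) else 0

/-! ### Viscosity sub-solutions -/

/-- The test functions on `J_T = (0,T) × J`: continuous on `J_T`, and on every branch `C^1` in
`(t, x_i) ∈ (0,T) × [0,∞)`, up to the boundary `x_i = 0`. -/
structure IsTestFunction {N : ℕ} (e : Fin N → Plane) (T : ℝ) (φ : ℝ → Plane → ℝ) : Prop where
  continuousOn : ContinuousOn (fun P : ℝ × Plane => φ P.1 P.2) (Ioo 0 T ×ˢ junction e)
  contDiffOn : ∀ i, ContDiffOn ℝ 1 (fun P : ℝ × ℝ => φ P.1 (P.2 • e i)) (Ioo 0 T ×ˢ Ici 0)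

/-- The time derivative `φ_t(t,x)`. -/
def timeDeriv (φ : ℝ → Plane → ℝ) (t : ℝ) (x : Plane) : ℝ :=
  deriv (fun s => φ s x) t

/-- The derivative `φ_x^i(t,x)` along the branch `J_i`, for `x = x_i e_i ∈ J_i` (so `x_i = ‖x‖`);
it is one-sided at the junction point. -/
def branchDeriv {N : ℕ} (e : Fin N → Plane) (φ : ℝ → Plane → ℝ) (i : Fin N) (t : ℝ) (x : Plane) :
    ℝ :=
  derivWithin (fun r : ℝ => φ t (r • e i)) (Ici 0) ‖x‖

/-- Viscosity sub-solutions, on `J_T = (0,T) × J`, of `u_t + H(x, u_x) = 0`, where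
`H(x, p) = H_i(p)` on `J_i^*` and `H(0, p) = max_i H_i^-(p_i)`. Only the values of `u` on
`[0,T) × J` are relevant. -/
structure IsSubsolution {N : ℕ} (e : Fin N → Plane) (L : Fin N → ℝ → ℝ) (T : ℝ)
    (u : ℝ → Plane → ℝ) : Prop where
  upperSemicontinuousOn :
    UpperSemicontinuousOn (fun P : ℝ × Plane => u P.1 P.2) (Ico 0 T ×ˢ junction e)
  viscosity : ∀ φ : ℝ → Plane → ℝ, IsTestFunction e T φ →
    ∀ t ∈ Ioo 0 T, ∀ x ∈ junction e,
      (∃ r > 0, ∀ s ∈ Ioo 0 T, ∀ y ∈ junction e,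
        |s - t| < r → geodist e y x < r → u s y ≤ φ s y) →
      u t x = φ t x →
      (∀ i, x ∈ openBranch e i →
        timeDeriv φ t x + hamiltonian (L i) (branchDeriv e φ i t x) ≤ 0) ∧
      (x = 0 →
        timeDeriv φ t 0 + (⨆ i, hamiltonianMinus (L i) (branchDeriv e φ i t 0)) ≤ 0)

/-- Sub-solutions of the equation with initial condition `u(0, ·) = u₀`. -/
structure IsSubsolutionWithInitialData {N : ℕ} (e : Fin N → Plane) (L : Fin N → ℝ → ℝ) (T : ℝ)
    (u₀ : Plane → ℝ) (u : ℝ → Plane → ℝ) : Prop extends IsSubsolution e L T u where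
  initial : ∀ x ∈ junction e, u 0 x ≤ u₀ x

/-! ### The optimal control problem -/

/-- The admissible controls at `x`: `ℝ e_i` if `x ∈ J_i^*`, and `⋃ i, [0,∞) e_i` if `x = 0`. -/
def controls {N : ℕ} (e : Fin N → Plane) (x : Plane) : Set Plane :=
  {P | (∃ i, x ∈ openBranch e i ∧ ∃ p : ℝ, P = p • e i) ∨
    (x = 0 ∧ ∃ i, ∃ p : ℝ, 0 ≤ p ∧ P = p • e i)}

/-- The admissible trajectories from `(s,y)` to `(t,x)`. A function of class `W^{1,1}` on `[s,t]`
is an absolutely continuous one, and its weak derivative is the almost everywhere derivative. -/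
structure IsAdmissible {N : ℕ} (e : Fin N → Plane) (s : ℝ) (y : Plane) (t : ℝ) (x : Plane)
    (X : ℝ → Plane) : Prop where
  absolutelyContinuous : AbsolutelyContinuousOnInterval X s t
  mem_junction : ∀ τ ∈ Ioo s t, X τ ∈ junction e
  deriv_mem : ∀ᵐ τ ∂(volume.restrict (Ioo s t)), deriv X τ ∈ controls e (X τ)
  left : X s = y
  right : X t = x

open Classical in
/-- The action `∫_s^t L(X, Ẋ) dτ ∈ (-∞, +∞]` of a trajectory. It is `+∞` if the integrand is not
integrable: the Lagrangians considered are bounded below, so the integral then diverges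
to `+∞`. -/
def action {N : ℕ} (e : Fin N → Plane) (L : Fin N → ℝ → ℝ) (s t : ℝ) (X : ℝ → Plane) : EReal :=
  if IntervalIntegrable (fun τ => lagrangian e L (X τ) (deriv X τ)) volume s t then
    ((∫ τ in s..t, lagrangian e L (X τ) (deriv X τ) : ℝ) : EReal)
  else ⊤

/-- The value function `u_oc(t,x)`: the infimum, over all `y ∈ J` and all admissible trajectories
`X` from `(0,y)` to `(t,x)`, of `u₀(y) + ∫_0^t L(X, Ẋ) dτ`. -/
def valueFunction {N : ℕ} (e : Fin N → Plane) (L : Fin N → ℝ → ℝ) (u₀ : Plane → ℝ)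
    (t : ℝ) (x : Plane) : EReal :=
  ⨅ (y : Plane) (_ : y ∈ junction e) (X : ℝ → Plane) (_ : IsAdmissible e 0 y t x X),
    ((u₀ y : ℝ) : EReal) + action e L 0 t X

end Junction

end

/-! A sub-solution satisfies the dynamic programming inequality `u(b, X(b)) ≤ u(a, X(a)) + ∫ L(X,
Ẋ)` along every trajectory of finite action; at `a = 0` the initial condition turns this into a
bound by the cost of `X`, and the infimum gives the claim. The equation is tested only on segments
of a branch run at constant velocity `q` (`IsSubsolution.le_add_of_line`). If the inequality failed
there, `u` minus a penalty concentrated around the moving point would have an interior maximum,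
where `φ_t + q φ_x ≤ L_i(q)` contradicts the choice of penalty. At the junction point `H_i^-` only
allows `q ≤ 0`; an outward segment starting there is a limit of segments starting just off it.
Convexity replaces trajectories by segments. Off the junction point a trajectory stays on one
branch, and Jensen's inequality makes the segment with the same ends cheaper. Between the first and
the last visit to the junction point, resting there at the rate `min_j L_j(0)` is cheaper, whatever
branches are visited, and resting is the segment with `q = 0`. So three pieces suffice. -/

namespace Junction

/-! ### Strong convexity of the Lagrangians and the Legendre transform. -/

section Convexity

theorem quadratic_tangent_le {ℓ : ℝ → ℝ} {γ : ℝ} (hℓ : ContDiff ℝ 2 ℓ)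
    (hℓ' : ∀ q, γ ≤ iteratedDeriv 2 ℓ q) (q p : ℝ) :
    ℓ q + deriv ℓ q * (p - q) + γ / 2 * (p - q) ^ 2 ≤ ℓ p := by
  rcases eq_or_ne q p with rfl | hqp
  · simp
  obtain ⟨z, -, hz⟩ := taylor_mean_remainder_lagrange_iteratedDeriv (n := 1) hqp
    (f := ℓ) (by exact_mod_cast hℓ.contDiffOn)
  have hd : derivWithin ℓ (uIcc q p) q = deriv ℓ q :=
    ((hℓ.differentiable (by norm_num)) q).derivWithin
      (uniqueDiffOn_uIcc hqp q left_mem_uIcc)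
  rw [taylorWithinEval_succ, taylor_within_zero_eval, iteratedDerivWithin_one, hd] at hz
  norm_num at hz
  have h2 := mul_le_mul_of_nonneg_right (hℓ' z) (sq_nonneg (p - q))
  nlinarith

theorem tangent_le {ℓ : ℝ → ℝ} {γ : ℝ} (hγ : 0 < γ) (hℓ : ContDiff ℝ 2 ℓ)
    (hℓ' : ∀ q, γ ≤ iteratedDeriv 2 ℓ q) (q p : ℝ) :
    ℓ q + deriv ℓ q * (p - q) ≤ ℓ p := by
  have := quadratic_tangent_le hℓ hℓ' q p
  have := mul_nonneg hγ.le (sq_nonneg (p - q))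
  linarith

/-- A real `⨆` of an unbounded family is `0` by convention, so this bound is what makes the
Hamiltonians true suprema. It follows from the quadratic minorant at `0` by completing the square.
-/
theorem bddAbove_legendre {ℓ : ℝ → ℝ} {γ : ℝ} (hγ : 0 < γ) (hℓ : ContDiff ℝ 2 ℓ)
    (hℓ' : ∀ q, γ ≤ iteratedDeriv 2 ℓ q) (p : ℝ) :
    BddAbove (range fun q : ℝ => p * q - ℓ q) := by
  refine ⟨(p - deriv ℓ 0) ^ 2 / (2 * γ) - ℓ 0, ?_⟩
  rintro _ ⟨q, rfl⟩
  have h := quadratic_tangent_le hℓ hℓ' 0 q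
  have h2 : (p - deriv ℓ 0) * q - γ / 2 * q ^ 2 ≤ (p - deriv ℓ 0) ^ 2 / (2 * γ) := by
    rw [le_div_iff₀ (by positivity)]
    nlinarith [sq_nonneg (γ * q - (p - deriv ℓ 0))]
  simp only [sub_zero] at h
  dsimp only
  linarith

theorem mul_sub_le_hamiltonian {ℓ : ℝ → ℝ} {γ : ℝ} (hγ : 0 < γ) (hℓ : ContDiff ℝ 2 ℓ)
    (hℓ' : ∀ q, γ ≤ iteratedDeriv 2 ℓ q) (p q : ℝ) :
    p * q - ℓ q ≤ hamiltonian ℓ p :=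
  le_ciSup (bddAbove_legendre hγ hℓ hℓ' p) q

theorem mul_sub_le_hamiltonianMinus {ℓ : ℝ → ℝ} {γ : ℝ} (hγ : 0 < γ) (hℓ : ContDiff ℝ 2 ℓ)
    (hℓ' : ∀ q, γ ≤ iteratedDeriv 2 ℓ q) (p : ℝ) {q : ℝ} (hq : q ≤ 0) :
    p * q - ℓ q ≤ hamiltonianMinus ℓ p := by
  refine le_ciSup (f := fun q : Set.Iic (0 : ℝ) => p * (q : ℝ) - ℓ (q : ℝ)) ?_ ⟨q, hq⟩
  refine (bddAbove_legendre hγ hℓ hℓ' p).mono ?_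
  rintro _ ⟨q, rfl⟩
  exact ⟨q, rfl⟩

end Convexity

/-! ### Arc-length coordinates on the branches. -/

section Coordinates

variable {N : ℕ} {e : Fin N → Plane}

/-- A coordinate on the `i`-th branch: a Lipschitz function on the plane which equals the
arc length on `J_i` and vanishes on the other branches. -/
structure IsCoordinate (e : Fin N → Plane) (i : Fin N) (ρ : Plane → ℝ) : Prop where
  lipschitz : ∃ K, LipschitzWith K ρ
  self : ∀ r : ℝ, 0 ≤ r → ρ (r • e i) = r
  other : ∀ j, j ≠ i → ∀ r : ℝ, 0 ≤ r → ρ (r • e j) = 0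
  nonneg : ∀ x, 0 ≤ ρ x

/-- Take `c < 1` above the cosines of the angles between `e i` and the other directions. The
positive part of `(⟪e i, x⟫ - c‖x‖) / (1 - c)` is the arc length on `J_i` and vanishes on the other
branches. -/
theorem exists_isCoordinate (he : ∀ i, ‖e i‖ = 1) (he' : Function.Injective e) (i : Fin N) :
    ∃ ρ, IsCoordinate e i ρ := by
  have hlt : ∀ j, j ≠ i → inner ℝ (e i) (e j) < 1 := fun j hj =>
    (inner_lt_one_iff_real_of_norm_eq_one (he i) (he j)).2 (fun h => hj (he' h.symm))
  obtain ⟨c, hc, hc1⟩ : ∃ c : ℝ, (∀ j, j ≠ i → inner ℝ (e i) (e j) < c) ∧ c < 1 := by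
    have h1 : ∀ᶠ c : ℝ in nhdsWithin 1 (Iio 1), ∀ j, j ≠ i → inner ℝ (e i) (e j) < c := by
      rw [Filter.eventually_all]
      intro j
      by_cases hj : j = i
      · simp [hj]
      · filter_upwards [mem_nhdsWithin_of_mem_nhds (Ioi_mem_nhds (hlt j hj))] with c hc _
        exact hc
    exact (h1.and self_mem_nhdsWithin).exists
  have h1c : 0 < 1 - c := by linarith
  refine ⟨fun x => max ((1 - c)⁻¹ * (inner ℝ (e i) x - c * ‖x‖)) 0, ?_, ?_, ?_, ?_⟩
  · have h1 : LipschitzWith ‖innerSL ℝ (e i)‖₊ (fun x : Plane => inner ℝ (e i) x) :=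
      (innerSL ℝ (e i)).lipschitz
    have h2 := (lipschitzWith_smul c).comp (lipschitzWith_one_norm (E := Plane))
    have h3 := (lipschitzWith_smul (1 - c)⁻¹).comp (h1.sub h2)
    exact ⟨_, by simpa [Function.comp_def] using h3.max_const 0⟩
  · intro r hr
    simp only [inner_smul_right, norm_smul, he, real_inner_self_eq_norm_sq, Real.norm_eq_abs,
      abs_of_nonneg hr]
    rw [max_eq_left] <;> field_simp
    exact hr
  · intro j hj r hr
    simp only [inner_smul_right, norm_smul, he, Real.norm_eq_abs, abs_of_nonneg hr]
    refine max_eq_right (mul_nonpos_of_nonneg_of_nonpos (by positivity) ?_)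
    nlinarith [hc j hj]
  · intro x
    exact le_max_right _ _

theorem mem_junction {x : Plane} : x ∈ junction e ↔ ∃ i, ∃ r : ℝ, 0 ≤ r ∧ x = r • e i := by
  simp [junction, branch]

theorem smul_mem_junction (i : Fin N) {r : ℝ} (hr : 0 ≤ r) : r • e i ∈ junction e :=
  mem_junction.2 ⟨i, r, hr, rfl⟩

theorem mem_openBranch (he : ∀ i, ‖e i‖ = 1) {i : Fin N} {x : Plane} :
    x ∈ openBranch e i ↔ ∃ r : ℝ, 0 < r ∧ x = r • e i := by
  have hi : e i ≠ 0 := fun h => by simpa [h] using he i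
  constructor
  · rintro ⟨⟨r, hr, rfl⟩, h0⟩
    refine ⟨r, lt_of_le_of_ne hr ?_, rfl⟩
    rintro rfl
    simp at h0
  · rintro ⟨r, hr, rfl⟩
    exact ⟨⟨r, hr.le, rfl⟩, by simp [hr.ne', hi]⟩

namespace IsCoordinate

variable {i : Fin N} {ρ : Plane → ℝ}

theorem continuous (hρ : IsCoordinate e i ρ) : Continuous ρ :=
  hρ.lipschitz.choose_spec.continuous

theorem zero (hρ : IsCoordinate e i ρ) : ρ 0 = 0 := by
  simpa using hρ.self 0 le_rfl

theorem le_norm (he : ∀ i, ‖e i‖ = 1) (hρ : IsCoordinate e i ρ) {x : Plane}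
    (hx : x ∈ junction e) : ρ x ≤ ‖x‖ := by
  obtain ⟨j, r, hr, rfl⟩ := mem_junction.1 hx
  rw [norm_smul, he, mul_one, Real.norm_eq_abs, abs_of_nonneg hr]
  by_cases hj : j = i
  · rw [hj, hρ.self r hr]
  · rwa [hρ.other j hj r hr]

theorem eq_smul (hρ : IsCoordinate e i ρ) {x : Plane} (hx : x ∈ junction e) (h : 0 < ρ x) :
    x = ρ x • e i := by
  obtain ⟨j, r, hr, rfl⟩ := mem_junction.1 hx
  by_cases hj : j = i
  · rw [hj, hρ.self r hr]
  · rw [hρ.other j hj r hr] at h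
    exact absurd h (lt_irrefl _)

theorem mem_openBranch_iff (he : ∀ i, ‖e i‖ = 1) (hρ : IsCoordinate e i ρ) {x : Plane}
    (hx : x ∈ junction e) : x ∈ openBranch e i ↔ 0 < ρ x := by
  rw [mem_openBranch he]
  constructor
  · rintro ⟨r, hr, rfl⟩
    rwa [hρ.self r hr.le]
  · intro h
    exact ⟨_, h, hρ.eq_smul hx h⟩

theorem eq_norm (he : ∀ i, ‖e i‖ = 1) (hρ : IsCoordinate e i ρ) {x : Plane}
    (hx : x ∈ openBranch e i) : ρ x = ‖x‖ := by
  obtain ⟨r, hr, rfl⟩ := (mem_openBranch he).1 hx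
  rw [hρ.self r hr.le, norm_smul, he, mul_one, Real.norm_eq_abs, abs_of_pos hr]

theorem eq_zero (he : ∀ i, ‖e i‖ = 1) (hρ : IsCoordinate e i ρ) {j : Fin N} (hj : j ≠ i)
    {x : Plane} (hx : x ∈ openBranch e j) : ρ x = 0 := by
  obtain ⟨r, hr, rfl⟩ := (mem_openBranch he).1 hx
  exact hρ.other j hj r hr.le

end IsCoordinate

theorem openBranch_unique (he : ∀ i, ‖e i‖ = 1) (he' : Function.Injective e) {i j : Fin N}
    {x : Plane} (hi : x ∈ openBranch e i) (hj : x ∈ openBranch e j) : i = j := by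
  obtain ⟨ρ, hρ⟩ := exists_isCoordinate he he' i
  by_contra h
  have h1 := hρ.eq_norm he hi
  rw [hρ.eq_zero he (Ne.symm h) hj] at h1
  exact hi.2 (by simpa using h1.symm)

theorem eq_zero_or_mem_openBranch (he : ∀ i, ‖e i‖ = 1) {x : Plane} (hx : x ∈ junction e) :
    x = 0 ∨ ∃ i, x ∈ openBranch e i := by
  obtain ⟨i, r, hr, rfl⟩ := mem_junction.1 hx
  rcases hr.eq_or_lt with rfl | hr
  · simp
  · exact Or.inr ⟨i, (mem_openBranch he).2 ⟨r, hr, rfl⟩⟩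

theorem isClosed_junction (he : ∀ i, ‖e i‖ = 1) : IsClosed (junction e) := by
  refine isClosed_iUnion_of_finite fun i => ?_
  have : branch e i = {x | x = ‖x‖ • e i} := by
    ext x
    constructor
    · rintro ⟨r, hr, rfl⟩
      simp [norm_smul, he, abs_of_nonneg hr]
    · intro h
      exact ⟨‖x‖, norm_nonneg x, h⟩
  rw [this]
  exact isClosed_eq continuous_id (by fun_prop)

/-- Hence touching in a Euclidean neighbourhood implies touching in a geodesic ball, as the
viscosity condition requires. -/
theorem norm_sub_le_geodist (x y : Plane) : ‖x - y‖ ≤ geodist e x y := by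
  unfold geodist
  split_ifs
  · exact le_rfl
  · exact norm_sub_le x y

end Coordinates

/-! ### Test functions adapted to one branch. -/

section TestFunctions

variable {N : ℕ} {e : Fin N → Plane} {i : Fin N} {ρ : Plane → ℝ} {f : ℝ → ℝ → ℝ}

/-- The test function given by `f` on the `i`-th branch and extended with slope `C` to the
other branches. -/
noncomputable def extendWithSlope (ρ : Plane → ℝ) (f : ℝ → ℝ → ℝ) (C t : ℝ) (x : Plane) : ℝ :=
  f t (ρ x) + C * (‖x‖ - ρ x)

theorem extendWithSlope_self (he : ∀ i, ‖e i‖ = 1) (hρ : IsCoordinate e i ρ) (C t : ℝ)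
    {r : ℝ} (hr : 0 ≤ r) : extendWithSlope ρ f C t (r • e i) = f t r := by
  simp [extendWithSlope, hρ.self r hr, norm_smul, he, abs_of_nonneg hr]

theorem extendWithSlope_other (he : ∀ i, ‖e i‖ = 1) (hρ : IsCoordinate e i ρ) (C t : ℝ)
    {j : Fin N} (hj : j ≠ i) {r : ℝ} (hr : 0 ≤ r) :
    extendWithSlope ρ f C t (r • e j) = f t 0 + C * r := by
  simp [extendWithSlope, hρ.other j hj r hr, norm_smul, he, abs_of_nonneg hr]

theorem continuous_extendWithSlope (hρ : IsCoordinate e i ρ)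
    (hf : Continuous fun P : ℝ × ℝ => f P.1 P.2) (C : ℝ) :
    Continuous fun P : ℝ × Plane => extendWithSlope ρ f C P.1 P.2 := by
  have h1 : Continuous fun P : ℝ × Plane => ρ P.2 := hρ.continuous.comp continuous_snd
  have h2 : Continuous fun P : ℝ × Plane => f P.1 (ρ P.2) :=
    hf.comp (continuous_fst.prodMk h1)
  exact h2.add (continuous_const.mul (continuous_snd.norm.sub h1))

theorem isTestFunction_extendWithSlope (he : ∀ i, ‖e i‖ = 1) (hρ : IsCoordinate e i ρ)
    (hf : ContDiff ℝ 1 fun P : ℝ × ℝ => f P.1 P.2) (C T : ℝ) :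
    IsTestFunction e T (extendWithSlope ρ f C) where
  continuousOn := (continuous_extendWithSlope hρ hf.continuous C).continuousOn
  contDiffOn j := by
    by_cases hj : j = i
    · subst hj
      exact hf.contDiffOn.congr fun P hP => extendWithSlope_self he hρ C P.1 hP.2
    · have h1 : ContDiff ℝ 1 fun P : ℝ × ℝ => f P.1 0 + C * P.2 :=
        (hf.comp (contDiff_fst.prodMk contDiff_const)).add (contDiff_const.mul contDiff_snd)
      exact h1.contDiffOn.congr fun P hP => extendWithSlope_other he hρ C P.1 hj hP.2

variable {L : Fin N → ℝ → ℝ} {γ : ℝ} {T : ℝ} {u : ℝ → Plane → ℝ}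

/-- What the viscosity inequalities say for the test functions `extendWithSlope`. -/
theorem IsSubsolution.inequalities_of_touching (he : ∀ i, ‖e i‖ = 1)
    (hγ : 0 < γ) (hL : ∀ i, ContDiff ℝ 2 (L i))
    (hL' : ∀ i q, γ ≤ iteratedDeriv 2 (L i) q) (hu : IsSubsolution e L T u)
    (hρ : IsCoordinate e i ρ) (hf : ContDiff ℝ 1 fun P : ℝ × ℝ => f P.1 P.2) {C t ft fr : ℝ}
    {x : Plane} (ht : t ∈ Ioo 0 T) (hx : x ∈ junction e)
    (hft : HasDerivAt (fun s => f s (ρ x)) ft t) (hfr : HasDerivAt (fun r => f t r) fr (ρ x))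
    (hmax : ∀ᶠ P : ℝ × Plane in nhds (t, x), P.1 ∈ Ioo 0 T → P.2 ∈ junction e →
      u P.1 P.2 ≤ extendWithSlope ρ f C P.1 P.2)
    (heq : u t x = extendWithSlope ρ f C t x) :
    (x ∈ openBranch e i → ∀ q, ft + q * fr ≤ L i q) ∧
    (x = 0 → ∀ q ≤ 0, ft + q * fr ≤ L i q) ∧
    (∀ j, j ≠ i → x ∈ openBranch e j → ft + C ≤ L j 1) := by
  obtain ⟨δ, hδ, hball⟩ := Metric.eventually_nhds_iff.1 hmax
  obtain ⟨hopen, hzero⟩ := hu.viscosity _ (isTestFunction_extendWithSlope he hρ hf C T) t ht x hx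
    ⟨δ, hδ, fun s hs y hy hst hyx => hball (y := (s, y)) (by
      rw [Prod.dist_eq, max_lt_iff, Real.dist_eq, dist_eq_norm]
      exact ⟨hst, (norm_sub_le_geodist y x).trans_lt hyx⟩) hs hy⟩ heq
  have htime : timeDeriv (extendWithSlope ρ f C) t x = ft := by
    have h1 : HasDerivAt (fun s => extendWithSlope ρ f C s x) ft t := hft.add_const _
    exact h1.deriv
  have hbranch : ρ x = ‖x‖ → branchDeriv e (extendWithSlope ρ f C) i t x = fr := by
    intro hn
    rw [hn] at hfr
    exact (hfr.hasDerivWithinAt.congr_of_mem (fun r hr => extendWithSlope_self he hρ C t hr)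
      (norm_nonneg x)).derivWithin (uniqueDiffOn_Ici 0 _ (norm_nonneg x))
  refine ⟨fun hi q => ?_, ?_, fun j hj hxj => ?_⟩
  · have h1 := hopen i hi
    rw [htime, hbranch (hρ.eq_norm he hi)] at h1
    linarith [mul_sub_le_hamiltonian hγ (hL i) (hL' i) fr q, mul_comm q fr]
  · rintro rfl q hq
    have h1 := hzero rfl
    rw [htime] at h1
    have h2 := le_ciSup (f := fun j => hamiltonianMinus (L j)
      (branchDeriv e (extendWithSlope ρ f C) j t 0)) (Finite.bddAbove_range _) i
    rw [hbranch (by rw [hρ.zero, norm_zero])] at h2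
    linarith [mul_sub_le_hamiltonianMinus hγ (hL i) (hL' i) fr hq, mul_comm q fr]
  · have h1 := hopen j hxj
    have h2 : branchDeriv e (extendWithSlope ρ f C) j t x = C := by
      have h3 : HasDerivAt (fun r => f t 0 + C * r) C ‖x‖ := by
        simpa using ((hasDerivAt_id ‖x‖).const_mul C).const_add (f t 0)
      exact (h3.hasDerivWithinAt.congr_of_mem
        (fun r hr => extendWithSlope_other he hρ C t hj hr)
        (norm_nonneg x)).derivWithin (uniqueDiffOn_Ici 0 _ (norm_nonneg x))
    rw [htime, h2] at h1
    -- Velocity `1` gives `H_j(C) ≥ C - L_j(1)`, which a steep slope makes as large as desired.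
    linarith [mul_sub_le_hamiltonian hγ (hL j) (hL' j) C 1]

end TestFunctions

/-! ### Dynamic programming along segments, by penalisation. -/

section Segments

variable {N : ℕ} {e : Fin N → Plane} {i : Fin N} {L : Fin N → ℝ → ℝ} {γ : ℝ} {T : ℝ}
  {u : ℝ → Plane → ℝ}

/-- The penalisation of the distance to a line in space-time and of the times after `b`, on a
branch. -/
noncomputable def linePenalty (l q a b r₁ η K A m s r : ℝ) : ℝ :=
  l * (s - a) + η * Real.exp (K * (s - b)) + A * (r - (r₁ + q * (s - a))) ^ 2 + m

theorem contDiff_linePenalty (l q a b r₁ η K A m : ℝ) :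
    ContDiff ℝ 1 fun P : ℝ × ℝ => linePenalty l q a b r₁ η K A m P.1 P.2 := by
  unfold linePenalty
  fun_prop

theorem hasDerivAt_linePenalty_left (l q a b r₁ η K A m s r : ℝ) :
    HasDerivAt (fun s => linePenalty l q a b r₁ η K A m s r)
      (l + η * (K * Real.exp (K * (s - b))) - q * (2 * A * (r - (r₁ + q * (s - a))))) s := by
  have h1 : HasDerivAt (fun s : ℝ => l * (s - a)) l s := by
    simpa using ((hasDerivAt_id s).sub_const a).const_mul l
  have h2 : HasDerivAt (fun s : ℝ => K * (s - b)) K s := by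
    simpa using ((hasDerivAt_id s).sub_const b).const_mul K
  have h3 : HasDerivAt (fun s : ℝ => r - (r₁ + q * (s - a))) (-q) s := by
    simpa using ((((hasDerivAt_id s).sub_const a).const_mul q).const_add r₁).const_sub r
  refine (((h1.add (h2.exp.const_mul η)).add ((h3.pow 2).const_mul A)).add_const m).congr_deriv ?_
  push_cast
  ring

theorem hasDerivAt_linePenalty_right (l q a b r₁ η K A m s r : ℝ) :
    HasDerivAt (fun r => linePenalty l q a b r₁ η K A m s r)
      (2 * A * (r - (r₁ + q * (s - a)))) r := by
  have h3 : HasDerivAt (fun r : ℝ => r - (r₁ + q * (s - a))) 1 r := by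
    simpa using (hasDerivAt_id r).sub_const (r₁ + q * (s - a))
  refine ((((h3.pow 2).const_mul A).const_add
    (l * (s - a) + η * Real.exp (K * (s - b)))).add_const m).congr_deriv ?_
  push_cast
  ring

/-- Converts the two quantities controlled by the penalties into Euclidean proximity. If `ρ x = 0`,
the condition on `w` leaves only `r = 0`. -/
theorem IsCoordinate.norm_sub_smul_lt (he : ∀ i, ‖e i‖ = 1) {ρ : Plane → ℝ}
    (hρ : IsCoordinate e i ρ) {x : Plane} (hx : x ∈ junction e) {r w : ℝ} (hr : 0 ≤ r)
    (hw : 0 < r → w < r) (h1 : |ρ x - r| < w) (h2 : ‖x‖ - ρ x < w) : ‖x - r • e i‖ < w := by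
  rcases (hρ.nonneg x).eq_or_lt with h0 | h0
  · rw [← h0] at h1 h2
    have hr0 : r = 0 := by
      by_contra hne
      have := hw (lt_of_le_of_ne hr (Ne.symm hne))
      rw [zero_sub, abs_neg, abs_of_nonneg hr] at h1
      linarith
    simpa [hr0] using h2
  · rw [hρ.eq_smul hx h0, ← sub_smul, norm_smul, he, mul_one, Real.norm_eq_abs]
    exact h1

theorem IsSubsolution.exists_radius (hu : IsSubsolution e L T u) {a : ℝ} (ha : a ∈ Ico 0 T)
    {x : Plane} (hx : x ∈ junction e) {η : ℝ} (hη : 0 < η) :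
    ∃ δ > 0, ∀ s ∈ Ico 0 T, ∀ y ∈ junction e, |s - a| < δ → ‖y - x‖ < δ →
      u s y < u a x + η := by
  have h1 := hu.upperSemicontinuousOn (a, x) ⟨ha, hx⟩ (u a x + η) (by simpa using hη)
  obtain ⟨δ, hδ, h2⟩ := Metric.eventually_nhds_iff.1 (eventually_nhdsWithin_iff.1 h1)
  refine ⟨δ, hδ, fun s hs y hy hsa hyx => h2 (y := (s, y)) ?_ ⟨hs, hy⟩⟩
  rw [Prod.dist_eq, max_lt_iff, Real.dist_eq, dist_eq_norm]
  exact ⟨hsa, hyx⟩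

/-- The dynamic programming inequality along a segment of a branch, if the segment does not
start at the junction point and move away from it. -/
theorem IsSubsolution.le_add_of_line (he : ∀ i, ‖e i‖ = 1)
    (he' : Function.Injective e) (hγ : 0 < γ) (hL : ∀ i, ContDiff ℝ 2 (L i))
    (hL' : ∀ i q, γ ≤ iteratedDeriv 2 (L i) q) (hu : IsSubsolution e L T u)
    {a b r₁ q : ℝ} (ha : 0 ≤ a) (hab : a < b) (hbT : b < T) (hr₁ : 0 ≤ r₁)
    (hr₂ : 0 ≤ r₁ + q * (b - a)) (hq : q ≤ 0 ∨ 0 < r₁) :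
    u b ((r₁ + q * (b - a)) • e i) ≤ u a (r₁ • e i) + (b - a) * L i q := by
  obtain ⟨ρ, hρ⟩ := exists_isCoordinate he he' i
  refine le_of_forall_pos_le_add fun ε hε => ?_
  by_contra! hlt
  -- One `η` pays for the time penalty at `b`, the other for upper semi-continuity at `a`.
  obtain ⟨η, hη, rfl⟩ : ∃ η : ℝ, 0 < η ∧ ε = 2 * η := ⟨ε / 2, by positivity, by ring⟩
  set x₁ := r₁ • e i with hx₁
  set l := L i q with hl
  obtain ⟨b', hbb', hb'T⟩ := exists_between hbT
  obtain ⟨δ, hδ, husc⟩ := hu.exists_radius (a := a) ⟨ha, by linarith⟩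
    (smul_mem_junction i hr₁) hη
  obtain ⟨w, hw0, hwδ, hwr⟩ : ∃ w : ℝ, 0 < w ∧ w < δ ∧ (0 < r₁ → w < r₁) := by
    rcases hr₁.eq_or_lt with h | h
    · exact ⟨δ / 2, by linarith, by linarith, fun h' => absurd h (ne_of_lt h')⟩
    · have := lt_min hδ h
      obtain ⟨w, hw0, hw⟩ := exists_between this
      exact ⟨w, hw0, hw.trans_le (min_le_left _ _), fun _ => hw.trans_le (min_le_right _ _)⟩
  -- Large enough that a point within the penalty tolerances of the line is interior to the ball of
  -- radius `R`.
  set R := r₁ + |q| * (b' - a) + 2 * w + 1 with hR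
  have hline : ∀ s ∈ Icc a b', |r₁ + q * (s - a)| ≤ R - 2 * w - 1 := by
    intro s hs
    calc |r₁ + q * (s - a)| ≤ |r₁| + |q * (s - a)| := abs_add_le _ _
      _ = r₁ + |q| * (s - a) := by
        rw [abs_mul, abs_of_nonneg hr₁, abs_of_nonneg (sub_nonneg.2 hs.1)]
      _ ≤ r₁ + |q| * (b' - a) := by gcongr; exact hs.2
      _ = R - 2 * w - 1 := by rw [hR]; ring
  have hR0 : 0 ≤ R - 2 * w - 1 := (abs_nonneg _).trans (hline a ⟨le_rfl, by linarith⟩)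
  set S : Set (ℝ × Plane) := Icc a b' ×ˢ (junction e ∩ Metric.closedBall 0 R) with hS
  have hScompact : IsCompact S := isCompact_Icc.prod
    ((isCompact_closedBall _ _).inter_left (isClosed_junction he))
  have husS : UpperSemicontinuousOn (fun P : ℝ × Plane => u P.1 P.2) S :=
    hu.upperSemicontinuousOn.mono fun P hP => ⟨⟨ha.trans hP.1.1, hP.1.2.trans_lt hb'T⟩, hP.2.1⟩
  obtain ⟨M, hM⟩ := husS.bddAbove_of_isCompact hScompact
  replace hM : ∀ P ∈ S, u P.1 P.2 ≤ M := fun P hP => hM ⟨P, hP, rfl⟩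
  -- At a point where `u - φ > u a x₁ + η` the three penalties add up to less than `B`. So `A`, `K`
  -- and `C` are chosen to make each of these cost at least `B` by itself: leaving the line by `w`,
  -- reaching time `b'`, going `w` into another branch.
  set B := |M + |l| * (b' - a) - (u a x₁ + η)| with hB
  have hB0 : 0 ≤ B := abs_nonneg _
  obtain ⟨A, hA0, hA⟩ : ∃ A : ℝ, 0 ≤ A ∧ B ≤ A * w ^ 2 :=
    ⟨B / w ^ 2, by positivity, by field_simp; exact le_rfl⟩
  obtain ⟨K, hK0, hK⟩ : ∃ K : ℝ, 0 < K ∧ B ≤ η * Real.exp (K * (b' - b)) := by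
    have hpos : 0 < η * (b' - b) := mul_pos hη (sub_pos.2 hbb')
    refine ⟨B / (η * (b' - b)) + 1, by positivity, ?_⟩
    have h1 := Real.add_one_le_exp ((B / (η * (b' - b)) + 1) * (b' - b))
    have h2 := mul_le_mul_of_nonneg_left h1 hη.le
    have h3 : B / (η * (b' - b)) * (η * (b' - b)) = B := div_mul_cancel₀ B hpos.ne'
    nlinarith
  obtain ⟨Λ, hΛ⟩ := Finite.bddAbove_range fun j => L j 1
  replace hΛ : ∀ j, L j 1 ≤ |Λ| := fun j => (hΛ ⟨j, rfl⟩).trans (le_abs_self _)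
  obtain ⟨C, hC0, hC, hCΛ⟩ : ∃ C : ℝ, 0 ≤ C ∧ B ≤ C * w ∧
      |Λ| + |l| + |q| * (2 * A * (R - 2 * w - 1)) < C := by
    have h0 : 0 ≤ |q| * (2 * A * (R - 2 * w - 1)) := by positivity
    refine ⟨B / w + (|Λ| + |l| + |q| * (2 * A * (R - 2 * w - 1)) + 1), by positivity, ?_, ?_⟩
    · have h3 : B / w * w = B := by field_simp
      rw [add_mul, h3]
      have : 0 ≤ (|Λ| + |l| + |q| * (2 * A * (R - 2 * w - 1)) + 1) * w := by positivity
      linarith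
    · have : 0 ≤ B / w := by positivity
      linarith
  set φ : ℝ → Plane → ℝ := extendWithSlope ρ (linePenalty l q a b r₁ η K A 0) C with hφ
  have hφapply : ∀ s x, φ s x = l * (s - a) + η * Real.exp (K * (s - b)) +
      A * (ρ x - (r₁ + q * (s - a))) ^ 2 + C * (‖x‖ - ρ x) := by
    intro s x
    simp [hφ, extendWithSlope, linePenalty]
  have hφcont : Continuous fun P : ℝ × Plane => -φ P.1 P.2 :=
    (continuous_extendWithSlope hρ (contDiff_linePenalty l q a b r₁ η K A 0).continuous C).neg
  have hx₂S : (b, (r₁ + q * (b - a)) • e i) ∈ S := by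
    refine ⟨⟨hab.le, hbb'.le⟩, smul_mem_junction i hr₂, ?_⟩
    rw [mem_closedBall_zero_iff, norm_smul, he, mul_one, Real.norm_eq_abs]
    linarith [hline b ⟨hab.le, hbb'.le⟩]
  obtain ⟨⟨t, x⟩, htx, hmax⟩ := UpperSemicontinuousOn.exists_isMaxOn ⟨_, hx₂S⟩ hScompact
    (husS.add (hφcont.continuousOn.upperSemicontinuousOn))
  obtain ⟨⟨hat, htb'⟩, hxJ, -⟩ := id htx
  dsimp only at hat htb' hxJ
  replace hmax : ∀ P ∈ S, u P.1 P.2 - φ P.1 P.2 ≤ u t x - φ t x := fun P hP => by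
    simpa [sub_eq_add_neg] using hmax hP
  have hm : u a x₁ + η < u t x - φ t x := by
    refine lt_of_lt_of_le ?_ (hmax _ hx₂S)
    dsimp only
    rw [hφapply, hρ.self _ hr₂, norm_smul, he, mul_one, Real.norm_eq_abs, abs_of_nonneg hr₂]
    simp only [sub_self, mul_zero, Real.exp_zero]
    linarith
  have hd0 : 0 ≤ ‖x‖ - ρ x := sub_nonneg.2 (hρ.le_norm he hxJ)
  have hpen1 : 0 ≤ η * Real.exp (K * (t - b)) := by positivity
  have hpen2 : 0 ≤ A * (ρ x - (r₁ + q * (t - a))) ^ 2 := by positivity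
  have hpen3 : 0 ≤ C * (‖x‖ - ρ x) := by positivity
  have hpen : η * Real.exp (K * (t - b)) + A * (ρ x - (r₁ + q * (t - a))) ^ 2 +
      C * (‖x‖ - ρ x) < B := by
    have h1 := hM _ htx
    dsimp only at h1
    have h2 : -(|l| * (b' - a)) ≤ l * (t - a) := by
      have h3 : |l * (t - a)| ≤ |l| * (b' - a) := by
        rw [abs_mul, abs_of_nonneg (sub_nonneg.2 hat)]
        gcongr
      exact (abs_le.1 h3).1
    have h4 := le_abs_self (M + |l| * (b' - a) - (u a x₁ + η))
    rw [hφapply] at hm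
    linarith
  have htb : t < b' := by
    refine lt_of_le_of_ne htb' ?_
    rintro rfl
    linarith
  have hdist : |ρ x - (r₁ + q * (t - a))| < w := by
    refine abs_lt_of_sq_lt_sq ?_ hw0.le
    have : A * (ρ x - (r₁ + q * (t - a))) ^ 2 < A * w ^ 2 := by linarith
    exact lt_of_mul_lt_mul_left this hA0
  have hdw : ‖x‖ - ρ x < w := by
    have : C * (‖x‖ - ρ x) < C * w := by linarith
    exact lt_of_mul_lt_mul_left this hC0
  -- At `t = a` the penalties put `x` within `δ` of `x₁`, where `u a x < u a x₁ + η`, against `hm`.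
  have hta : a < t := by
    refine lt_of_le_of_ne hat ?_
    rintro rfl
    rw [sub_self, mul_zero, add_zero] at hdist
    have h1 := husc a ⟨ha, by linarith⟩ x hxJ (by simpa using hδ)
      ((hρ.norm_sub_smul_lt he hxJ hr₁ hwr hdist hdw).trans hwδ)
    rw [hφapply, sub_self, mul_zero, zero_add, mul_zero, add_zero] at hm
    rw [sub_self, mul_zero, add_zero] at hpen2
    linarith
  have hxR : ‖x‖ < R := by
    have h1 := (abs_lt.1 hdist).2
    have h2 := (le_abs_self _).trans (hline t ⟨hat, htb'⟩)
    linarith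
  have htT : t ∈ Ioo 0 T := ⟨ha.trans_lt hta, htb.trans hb'T⟩
  set m := u t x - φ t x with hm_def
  have hshift : ∀ s y,
      extendWithSlope ρ (linePenalty l q a b r₁ η K A m) C s y = φ s y + m := by
    intro s y
    simp only [hφ, extendWithSlope, linePenalty]
    ring
  obtain ⟨hself, hzero, hother⟩ := hu.inequalities_of_touching he hγ hL hL' hρ
    (contDiff_linePenalty l q a b r₁ η K A m) (C := C) htT hxJ
    (hasDerivAt_linePenalty_left l q a b r₁ η K A m t (ρ x))
    (hasDerivAt_linePenalty_right l q a b r₁ η K A m t (ρ x))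
    (by
      have h1 : ∀ᶠ P : ℝ × Plane in nhds (t, x), P.1 ∈ Ioo a b' ∧ ‖P.2‖ < R := by
        refine Filter.Eventually.and ?_ ?_
        · exact continuous_fst.continuousAt.eventually (Ioo_mem_nhds hta htb)
        · exact continuous_snd.norm.continuousAt.eventually (Iio_mem_nhds hxR)
      filter_upwards [h1] with P hP _ hPJ
      have h2 := hmax P ⟨⟨hP.1.1.le, hP.1.2.le⟩, hPJ, by
        rw [mem_closedBall_zero_iff]; exact hP.2.le⟩
      rw [hshift]
      linarith)
    (by rw [hshift, hm_def]; ring)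
  -- The square is transported at velocity `q`, so its contributions to `φ_t + q φ_x` cancel. What
  -- remains is `l` plus this positive term, which cannot be at most `L i q = l`.
  have hexp : 0 < η * (K * Real.exp (K * (t - b))) := by positivity
  rcases eq_zero_or_mem_openBranch he hxJ with h0 | ⟨j, hj⟩
  · have hq0 : q ≤ 0 := by
      rcases hq with hq | hr
      · exact hq
      -- Moving outward from `r₁ > w`, the line never comes within `w` of the junction point.
      · by_contra! hq0
        rw [h0, hρ.zero, zero_sub, abs_neg] at hdist
        have h1 := (le_abs_self _).trans_lt hdist
        have h2 := hwr hr
        have h3 : 0 < q * (t - a) := mul_pos hq0 (sub_pos.2 hta)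
        linarith
    have := hzero h0 q hq0
    linarith
  · by_cases hji : j = i
    · have := hself (hji ▸ hj) q
      linarith
    -- On a wrong branch the slope `C` dominates the time derivative and `L j 1`.
    · have h1 := hother j hji hj
      have h2 := hΛ j
      rw [hρ.eq_zero he hji hj, zero_sub] at h1
      have h3 : |q * (2 * A * -(r₁ + q * (t - a)))| ≤ |q| * (2 * A * (R - 2 * w - 1)) := by
        rw [abs_mul, abs_mul, abs_neg, abs_of_nonneg (by positivity : 0 ≤ 2 * A)]
        gcongr
        exact hline t ⟨hat, htb'⟩
      have h4 := (abs_le.1 h3).2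
      have h5 := neg_abs_le l
      linarith

/-- The dynamic programming inequality along a segment of a branch. -/
theorem IsSubsolution.le_add_of_segment (he : ∀ i, ‖e i‖ = 1)
    (he' : Function.Injective e) (hγ : 0 < γ) (hL : ∀ i, ContDiff ℝ 2 (L i))
    (hL' : ∀ i q, γ ≤ iteratedDeriv 2 (L i) q) (hu : IsSubsolution e L T u)
    {a b r₁ r₂ : ℝ} (ha : 0 ≤ a) (hab : a < b) (hbT : b < T) (hr₁ : 0 ≤ r₁) (hr₂ : 0 ≤ r₂) :
    u b (r₂ • e i) ≤ u a (r₁ • e i) + (b - a) * L i ((r₂ - r₁) / (b - a)) := by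
  have hba : 0 < b - a := sub_pos.2 hab
  set q := (r₂ - r₁) / (b - a) with hq
  have hr : r₂ = r₁ + q * (b - a) := by rw [hq]; field_simp; ring
  rw [hr] at hr₂ ⊢
  by_cases hcase : q ≤ 0 ∨ 0 < r₁
  · exact hu.le_add_of_line he he' hγ hL hL' ha hab hbT hr₁ hr₂ hcase
  push Not at hcase
  obtain ⟨hq0, hr₁'⟩ := hcase
  obtain rfl : r₁ = 0 := le_antisymm hr₁' hr₁
  refine le_of_forall_pos_le_add fun η hη => ?_
  obtain ⟨δ, hδ, husc⟩ := hu.exists_radius (a := a) ⟨ha, by linarith⟩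
    (smul_mem_junction (e := e) i hr₁) (half_pos hη)
  -- Start instead at time `a + d`, at the point `q * d` of the same segment. Upper semi-continuity
  -- at `(a, 0)` and the smallness of `d * L i q` cost `η / 2` each.
  have hev : ∀ᶠ d : ℝ in nhdsWithin 0 (Ioi 0), d < δ ∧ q * d < δ ∧ d < b - a ∧
      -d * L i q < η / 2 := by
    have hlim : ∀ (g : ℝ → ℝ) (y : ℝ), Continuous g → g 0 < y →
        ∀ᶠ d : ℝ in nhdsWithin 0 (Ioi 0), g d < y := fun g y hg hy =>
      (hg.continuousAt.eventually (Iio_mem_nhds hy)).filter_mono nhdsWithin_le_nhds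
    exact (hlim id δ continuous_id hδ).and ((hlim (fun d => q * d) δ (by fun_prop) (by simpa)).and
      ((hlim id _ continuous_id hba).and
        (hlim (fun d => -d * L i q) _ (by fun_prop) (by simpa using hη))))
  obtain ⟨d, ⟨hdδ, hqd, hdb, hdL⟩, hd0⟩ := (hev.and self_mem_nhdsWithin).exists
  have hqd0 : 0 < q * d := mul_pos hq0 hd0
  have h1 := hu.le_add_of_line (i := i) he he' hγ hL hL' (a := a + d) (b := b) (r₁ := q * d)
    (q := q) (by linarith) (by linarith) hbT hqd0.le
    (by have : 0 < q * (b - (a + d)) := mul_pos hq0 (by linarith)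
        linarith) (Or.inr hqd0)
  have h2 := husc (a + d) ⟨by linarith, by linarith⟩ ((q * d) • e i)
    (smul_mem_junction i hqd0.le) (by simpa [abs_of_pos hd0] using hdδ)
    (by simpa [norm_smul, he, abs_of_pos hq0, abs_of_pos hd0] using hqd)
  have h3 : q * d + q * (b - (a + d)) = 0 + q * (b - a) := by ring
  rw [h3] at h1
  linarith

end Segments

/-! ### Reduction of trajectories to segments. -/

section Trajectories

theorem _root_.LipschitzWith.comp_absolutelyContinuousOnInterval {E F : Type*}
    [PseudoMetricSpace E] [PseudoMetricSpace F] {g : E → F} {K : NNReal} (hg : LipschitzWith K g)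
    {X : ℝ → E} {a b : ℝ} (hX : AbsolutelyContinuousOnInterval X a b) :
    AbsolutelyContinuousOnInterval (g ∘ X) a b := by
  unfold AbsolutelyContinuousOnInterval at hX ⊢
  refine squeeze_zero (fun _ => Finset.sum_nonneg fun _ _ => dist_nonneg) (fun E => ?_)
    (by simpa using Filter.Tendsto.const_mul (K : ℝ) hX)
  rw [Finset.mul_sum]
  exact Finset.sum_le_sum fun j _ => hg.dist_le_mul _ _

variable {N : ℕ} {e : Fin N → Plane} {L : Fin N → ℝ → ℝ} {ρ : Fin N → Plane → ℝ}

theorem lagrangian_of_mem_openBranch (he : ∀ i, ‖e i‖ = 1) (he' : Function.Injective e)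
    {i : Fin N} {x : Plane} (hx : x ∈ openBranch e i) (p : ℝ) :
    lagrangian e L x (p • e i) = L i p := by
  have h0 : x ≠ 0 := fun h => hx.2 h
  rw [lagrangian, if_neg h0, Finset.sum_eq_single i]
  · rw [if_pos hx, inner_smul_right, real_inner_self_eq_norm_sq, he]
    simp
  · intro j _ hj
    exact if_neg fun h => hj (openBranch_unique he he' h hx)
  · simp

/-- The velocity and the running cost of a trajectory, in terms of the coordinates. -/
theorem ae_lagrangian_eq (he : ∀ i, ‖e i‖ = 1) (he' : Function.Injective e)
    (hρ : ∀ i, IsCoordinate e i (ρ i)) {a b : ℝ} {X : ℝ → Plane}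
    (hX : AbsolutelyContinuousOnInterval X a b) (hXJ : ∀ τ ∈ Ioo a b, X τ ∈ junction e) :
    ∀ᵐ τ, τ ∈ Ioo a b →
      (∀ i, X τ ∈ openBranch e i →
        lagrangian e L (X τ) (deriv X τ) = L i (deriv (ρ i ∘ X) τ) ∧
        ∀ j, j ≠ i → deriv (ρ j ∘ X) τ = 0) ∧
      (X τ = 0 → lagrangian e L (X τ) (deriv X τ) = (⨅ j, L j 0) ∧
        ∀ j, deriv (ρ j ∘ X) τ = 0) := by
  have hρX : ∀ i, ∀ᵐ τ, τ ∈ uIcc a b → DifferentiableAt ℝ (ρ i ∘ X) τ := fun i =>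
    ((hρ i).lipschitz.choose_spec.comp_absolutelyContinuousOnInterval hX).ae_differentiableAt
  have hnX : ∀ᵐ τ, τ ∈ uIcc a b → DifferentiableAt ℝ (norm ∘ X) τ :=
    (lipschitzWith_one_norm.comp_absolutelyContinuousOnInterval hX).ae_differentiableAt
  filter_upwards [ae_all_iff.2 hρX, hnX] with τ h1 h2 hτ
  have hab : a ≤ b := (hτ.1.trans hτ.2).le
  have hτ' : τ ∈ uIcc a b := by rw [uIcc_of_le hab]; exact Ioo_subset_Icc_self hτ
  have hnhds : Ioo a b ∈ nhds τ := Ioo_mem_nhds hτ.1 hτ.2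
  have hcont : ContinuousAt X τ := hX.continuousOn.continuousAt
    (by rw [uIcc_of_le hab]; exact Filter.mem_of_superset hnhds Ioo_subset_Icc_self)
  refine ⟨fun i hi => ?_, fun h0 => ?_⟩
  · have hev : ∀ᶠ s in nhds τ, X s ∈ junction e ∧ 0 < ρ i (X s) := by
      refine (Filter.eventually_of_mem hnhds hXJ).and ?_
      exact ((hρ i).continuous.continuousAt.comp hcont).eventually
        (Ioi_mem_nhds (((hρ i).mem_openBranch_iff he (hXJ τ hτ)).1 hi))
    have hder : HasDerivAt X (deriv (ρ i ∘ X) τ • e i) τ := by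
      refine ((h1 i hτ').hasDerivAt.smul_const (e i)).congr_of_eventuallyEq ?_
      filter_upwards [hev] with s hs
      exact (hρ i).eq_smul hs.1 hs.2
    refine ⟨by rw [hder.deriv, lagrangian_of_mem_openBranch he he' hi], fun j hj => ?_⟩
    have hz : ρ j ∘ X =ᶠ[nhds τ] fun _ => 0 := by
      filter_upwards [hev] with s hs
      exact (hρ j).eq_zero he hj.symm (((hρ i).mem_openBranch_iff he hs.1).2 hs.2)
    rw [hz.deriv_eq, deriv_const]
  -- At a visit to the junction point the coordinates and the norm are minimal, so their derivatives
  -- vanish; for the norm this forces `Ẋ = 0`.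
  · have hmin : ∀ g : Plane → ℝ, (∀ x, 0 ≤ g x) → g 0 = 0 → deriv (g ∘ X) τ = 0 := by
      intro g hg hg0
      refine IsLocalMin.deriv_eq_zero (Filter.Eventually.of_forall fun s => ?_)
      simp [h0, hg0, hg]
    refine ⟨?_, fun j => hmin _ (hρ j).nonneg (hρ j).zero⟩
    have hder : HasDerivAt X 0 τ := by
      have h3 : HasDerivAt (norm ∘ X) 0 τ := by
        have := (h2 hτ').hasDerivAt
        rwa [hmin norm norm_nonneg norm_zero] at this
      rw [hasDerivAt_iff_isLittleO] at h3 ⊢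
      simpa [h0] using h3
    rw [hder.deriv, lagrangian, if_pos h0, norm_zero]

variable {γ : ℝ} {a b : ℝ} {X : ℝ → Plane}

/-- A trajectory on one branch costs at least as much as the segment between its ends. -/
theorem segment_le_integral_lagrangian (he : ∀ i, ‖e i‖ = 1) (he' : Function.Injective e)
    (hγ : 0 < γ) (hL : ∀ i, ContDiff ℝ 2 (L i)) (hL' : ∀ i q, γ ≤ iteratedDeriv 2 (L i) q)
    (hρ : ∀ i, IsCoordinate e i (ρ i)) (hab : a < b)
    (hX : AbsolutelyContinuousOnInterval X a b) {i : Fin N}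
    (hXi : ∀ τ ∈ Ioo a b, X τ ∈ openBranch e i)
    (hint : IntervalIntegrable (fun τ => lagrangian e L (X τ) (deriv X τ)) volume a b) :
    (b - a) * L i ((ρ i (X b) - ρ i (X a)) / (b - a)) ≤
      ∫ τ in a..b, lagrangian e L (X τ) (deriv X τ) := by
  have hρX := (hρ i).lipschitz.choose_spec.comp_absolutelyContinuousOnInterval hX
  have hba : 0 < b - a := sub_pos.2 hab
  set q := (ρ i (X b) - ρ i (X a)) / (b - a) with hq
  have hqb : q * (b - a) = ρ i (X b) - ρ i (X a) := div_mul_cancel₀ _ hba.ne'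
  have hint' : IntervalIntegrable
      (fun τ => L i q - deriv (L i) q * q + deriv (L i) q * deriv (ρ i ∘ X) τ) volume a b :=
    intervalIntegrable_const.add (hρX.intervalIntegrable_deriv.const_mul _)
  -- Jensen's inequality: the tangent to `L i` at the mean velocity `q` is a minorant whose integral
  -- depends only on the ends.
  calc (b - a) * L i q
      = ∫ τ in a..b, (L i q - deriv (L i) q * q + deriv (L i) q * deriv (ρ i ∘ X) τ) := by
        rw [intervalIntegral.integral_add intervalIntegrable_const
          (hρX.intervalIntegrable_deriv.const_mul _), intervalIntegral.integral_const,
          intervalIntegral.integral_const_mul, hρX.integral_deriv_eq_sub]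
        simp only [Function.comp_apply, smul_eq_mul]
        rw [← hqb]
        ring
    _ ≤ _ := by
        refine intervalIntegral.integral_mono_ae_restrict hab.le hint' hint ?_
        rw [← Measure.restrict_congr_set Ioo_ae_eq_Icc]
        refine (ae_restrict_iff' measurableSet_Ioo).2 ?_
        filter_upwards [ae_lagrangian_eq (L := L) he he' hρ hX
          fun τ hτ => mem_iUnion.2 ⟨i, (hXi τ hτ).1⟩] with τ hτ hab
        rw [((hτ hab).1 i (hXi τ hab)).1]
        linarith [tangent_le hγ (hL i) (hL' i) q (deriv (ρ i ∘ X) τ)]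

/-- A loop at the junction point costs at least as much as staying there. -/
theorem loop_le_integral_lagrangian (he : ∀ i, ‖e i‖ = 1) (he' : Function.Injective e)
    (hγ : 0 < γ) (hL : ∀ i, ContDiff ℝ 2 (L i)) (hL' : ∀ i q, γ ≤ iteratedDeriv 2 (L i) q)
    (hρ : ∀ i, IsCoordinate e i (ρ i)) (hab : a ≤ b)
    (hX : AbsolutelyContinuousOnInterval X a b) (hXJ : ∀ τ ∈ Ioo a b, X τ ∈ junction e)
    (ha : X a = 0) (hb : X b = 0)
    (hint : IntervalIntegrable (fun τ => lagrangian e L (X τ) (deriv X τ)) volume a b) :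
    (b - a) * (⨅ j, L j 0) ≤ ∫ τ in a..b, lagrangian e L (X τ) (deriv X τ) := by
  have hρX : ∀ i, AbsolutelyContinuousOnInterval (ρ i ∘ X) a b := fun i =>
    (hρ i).lipschitz.choose_spec.comp_absolutelyContinuousOnInterval hX
  have hterm : ∀ i ∈ Finset.univ, IntervalIntegrable
      (fun τ => deriv (L i) 0 * deriv (ρ i ∘ X) τ) volume a b := fun i _ =>
    (hρX i).intervalIntegrable_deriv.const_mul _
  have hsum : IntervalIntegrable
      (fun τ => ∑ i, deriv (L i) 0 * deriv (ρ i ∘ X) τ) volume a b := by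
    simpa only [Finset.sum_fn] using IntervalIntegrable.sum Finset.univ hterm
  -- The minorant adds the tangents at velocity `0` over all branches. Almost everywhere at most one
  -- coordinate moves, so it lies below the cost; each coordinate returns to `0`, so the sum
  -- integrates to zero.
  calc (b - a) * (⨅ j, L j 0)
      = ∫ τ in a..b, ((⨅ j, L j 0) + ∑ i, deriv (L i) 0 * deriv (ρ i ∘ X) τ) := by
        rw [intervalIntegral.integral_add intervalIntegrable_const hsum,
          intervalIntegral.integral_const, intervalIntegral.integral_finsetSum hterm]
        simp [intervalIntegral.integral_const_mul, (hρX _).integral_deriv_eq_sub, ha, hb]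
    _ ≤ _ := by
        refine intervalIntegral.integral_mono_ae_restrict hab
          (intervalIntegrable_const.add hsum) hint ?_
        rw [← Measure.restrict_congr_set Ioo_ae_eq_Icc]
        refine (ae_restrict_iff' measurableSet_Ioo).2 ?_
        filter_upwards [ae_lagrangian_eq (L := L) he he' hρ hX hXJ] with τ hτ hab
        rcases eq_zero_or_mem_openBranch he (hXJ τ hab) with h0 | ⟨i, hi⟩
        · obtain ⟨h1, h2⟩ := (hτ hab).2 h0
          simp [h1, h2]
        · obtain ⟨h1, h2⟩ := (hτ hab).1 i hi
          rw [h1, Finset.sum_eq_single i (fun j _ hj => by rw [h2 j hj, mul_zero]) (by simp)]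
          have h3 := ciInf_le (Finite.bddBelow_range fun j => L j 0) i
          have h4 := tangent_le hγ (hL i) (hL' i) 0 (deriv (ρ i ∘ X) τ)
          rw [sub_zero] at h4
          linarith

/-- A trajectory that avoids the junction point stays on one branch. -/
theorem exists_forall_mem_openBranch (he : ∀ i, ‖e i‖ = 1)
    (hρ : ∀ i, IsCoordinate e i (ρ i)) {S : Set ℝ} (hS : IsPreconnected S) (hne : S.Nonempty)
    (hX : ContinuousOn X S) (hXJ : ∀ τ ∈ S, X τ ∈ junction e) (h0 : ∀ τ ∈ S, X τ ≠ 0) :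
    ∃ i, ∀ τ ∈ S, X τ ∈ openBranch e i := by
  obtain ⟨σ, hσ⟩ := hne
  obtain ⟨i, hi⟩ := (eq_zero_or_mem_openBranch he (hXJ σ hσ)).resolve_left (h0 σ hσ)
  refine ⟨i, fun τ hτ => ((hρ i).mem_openBranch_iff he (hXJ τ hτ)).2 ?_⟩
  by_contra hn
  have hz : ρ i (X τ) = 0 := le_antisymm (not_lt.1 hn) ((hρ i).nonneg _)
  -- On the junction this function is `‖X‖` on `J_i` and `-‖X‖` elsewhere, so a change of branch
  -- would force a zero of `X`.
  have hcont : ContinuousOn (fun s => 2 * ρ i (X s) - ‖X s‖) S :=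
    (continuousOn_const.mul ((hρ i).continuous.comp_continuousOn hX)).sub hX.norm
  have hmem : (0 : ℝ) ∈ Icc (2 * ρ i (X τ) - ‖X τ‖) (2 * ρ i (X σ) - ‖X σ‖) := by
    rw [hz, (hρ i).eq_norm he hi]
    constructor <;> linarith [norm_nonneg (X τ), norm_nonneg (X σ)]
  obtain ⟨s, hs, hs0⟩ := hS.intermediate_value hτ hσ hcont hmem
  dsimp only at hs0
  obtain ⟨j, hj⟩ := (eq_zero_or_mem_openBranch he (hXJ s hs)).resolve_left (h0 s hs)
  have hpos := norm_pos_iff.2 (h0 s hs)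
  by_cases hji : j = i
  · rw [(hρ i).eq_norm he (hji ▸ hj)] at hs0
    linarith
  · rw [(hρ i).eq_zero he hji hj] at hs0
    linarith

variable {T : ℝ} {u : ℝ → Plane → ℝ}

/-- The dynamic programming inequality along a trajectory that avoids the junction point. -/
theorem IsSubsolution.le_add_integral_of_ne_zero (he : ∀ i, ‖e i‖ = 1)
    (he' : Function.Injective e) (hγ : 0 < γ) (hL : ∀ i, ContDiff ℝ 2 (L i))
    (hL' : ∀ i q, γ ≤ iteratedDeriv 2 (L i) q) (hu : IsSubsolution e L T u)
    (ha : 0 ≤ a) (hab : a ≤ b) (hbT : b < T)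
    (hX : AbsolutelyContinuousOnInterval X a b) (hXJ : ∀ τ ∈ Icc a b, X τ ∈ junction e)
    (h0 : ∀ τ ∈ Ioo a b, X τ ≠ 0)
    (hint : IntervalIntegrable (fun τ => lagrangian e L (X τ) (deriv X τ)) volume a b) :
    u b (X b) ≤ u a (X a) + ∫ τ in a..b, lagrangian e L (X τ) (deriv X τ) := by
  rcases hab.eq_or_lt with rfl | hab
  · simp
  choose ρ hρ using exists_isCoordinate he he'
  have hcont : ContinuousOn X (Icc a b) := uIcc_of_le hab.le ▸ hX.continuousOn
  obtain ⟨i, hi⟩ := exists_forall_mem_openBranch he hρ isPreconnected_Ioo (nonempty_Ioo.2 hab)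
    (hcont.mono Ioo_subset_Icc_self) (fun τ hτ => hXJ τ (Ioo_subset_Icc_self hτ)) h0
  -- The ends may be the junction point, which lies on no open branch; the identity reaches them by
  -- continuity.
  have heq : EqOn X (fun τ => ρ i (X τ) • e i) (Icc a b) := by
    refine EqOn.of_subset_closure (s := Ioo a b) (fun τ hτ => ?_) hcont
      (((hρ i).continuous.comp_continuousOn hcont).smul continuousOn_const)
      Ioo_subset_Icc_self (closure_Ioo hab.ne).ge
    have hJ := hXJ τ (Ioo_subset_Icc_self hτ)
    exact (hρ i).eq_smul hJ (((hρ i).mem_openBranch_iff he hJ).1 (hi τ hτ))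
  have h1 := hu.le_add_of_segment (i := i) he he' hγ hL hL' ha hab hbT
    ((hρ i).nonneg (X a)) ((hρ i).nonneg (X b))
  have hXa : X a = ρ i (X a) • e i := heq (left_mem_Icc.2 hab.le)
  have hXb : X b = ρ i (X b) • e i := heq (right_mem_Icc.2 hab.le)
  rw [← hXa, ← hXb] at h1
  linarith [segment_le_integral_lagrangian he he' hγ hL hL' hρ hab hX hi hint]

/-- The dynamic programming inequality along a loop at the junction point. -/
theorem IsSubsolution.le_add_integral_of_loop (hN : 1 ≤ N) (he : ∀ i, ‖e i‖ = 1)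
    (he' : Function.Injective e) (hγ : 0 < γ) (hL : ∀ i, ContDiff ℝ 2 (L i))
    (hL' : ∀ i q, γ ≤ iteratedDeriv 2 (L i) q) (hu : IsSubsolution e L T u)
    (ha : 0 ≤ a) (hab : a ≤ b) (hbT : b < T)
    (hX : AbsolutelyContinuousOnInterval X a b) (hXJ : ∀ τ ∈ Icc a b, X τ ∈ junction e)
    (hXa : X a = 0) (hXb : X b = 0)
    (hint : IntervalIntegrable (fun τ => lagrangian e L (X τ) (deriv X τ)) volume a b) :
    u b (X b) ≤ u a (X a) + ∫ τ in a..b, lagrangian e L (X τ) (deriv X τ) := by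
  rcases hab.eq_or_lt with rfl | hab
  · simp
  choose ρ hρ using exists_isCoordinate he he'
  have : Nonempty (Fin N) := ⟨⟨0, hN⟩⟩
  -- Resting at the junction point is the degenerate segment of the branch with the smallest `L j
  -- 0`.
  obtain ⟨i, hi⟩ := exists_eq_ciInf_of_finite (f := fun j => L j 0)
  have h1 := hu.le_add_of_segment (i := i) he he' hγ hL hL' ha hab hbT le_rfl le_rfl
  rw [sub_zero, zero_div, zero_smul, hi] at h1
  rw [hXa, hXb]
  linarith [loop_le_integral_lagrangian he he' hγ hL hL' hρ hab.le hX
    (fun τ hτ => hXJ τ (Ioo_subset_Icc_self hτ)) hXa hXb hint]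

/-- The dynamic programming inequality along a trajectory. -/
theorem IsSubsolution.le_add_integral (hN : 1 ≤ N) (he : ∀ i, ‖e i‖ = 1)
    (he' : Function.Injective e) (hγ : 0 < γ) (hL : ∀ i, ContDiff ℝ 2 (L i))
    (hL' : ∀ i q, γ ≤ iteratedDeriv 2 (L i) q) (hu : IsSubsolution e L T u)
    (ha : 0 ≤ a) (hab : a ≤ b) (hbT : b < T)
    (hX : AbsolutelyContinuousOnInterval X a b) (hXJ : ∀ τ ∈ Icc a b, X τ ∈ junction e)
    (hint : IntervalIntegrable (fun τ => lagrangian e L (X τ) (deriv X τ)) volume a b) :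
    u b (X b) ≤ u a (X a) + ∫ τ in a..b, lagrangian e L (X τ) (deriv X τ) := by
  have hcont : ContinuousOn X (Icc a b) := uIcc_of_le hab ▸ hX.continuousOn
  rcases (Icc a b ∩ X ⁻¹' {0}).eq_empty_or_nonempty with hZ | hZ
  · refine hu.le_add_integral_of_ne_zero he he' hγ hL hL' ha hab hbT hX hXJ
      (fun τ hτ h0 => ?_) hint
    have : τ ∈ Icc a b ∩ X ⁻¹' {0} := ⟨Ioo_subset_Icc_self hτ, h0⟩
    simp [hZ] at this
  have hZc : IsCompact (Icc a b ∩ X ⁻¹' {0}) := isCompact_Icc.of_isClosed_subset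
    (hcont.preimage_isClosed_of_isClosed isClosed_Icc isClosed_singleton) inter_subset_left
  -- Cutting at the first and last visits avoids handling the possibly infinitely many excursions
  -- between them.
  obtain ⟨c, ⟨⟨hac, hcb⟩, hXc⟩, hcmin⟩ := hZc.exists_isLeast hZ
  obtain ⟨d, ⟨⟨had, hdb⟩, hXd⟩, hdmax⟩ := hZc.exists_isGreatest hZ
  have hcd : c ≤ d := hcmin ⟨⟨had, hdb⟩, hXd⟩
  have hsub : ∀ {s t}, a ≤ s → s ≤ t → t ≤ b → uIcc s t ⊆ uIcc a b := fun hs hst ht => by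
    rw [uIcc_of_le hst, uIcc_of_le hab]
    exact Icc_subset_Icc hs ht
  have hac' := hsub le_rfl hac hcb
  have hcd' := hsub hac hcd hdb
  have hdb' := hsub had hdb le_rfl
  have h1 := hu.le_add_integral_of_ne_zero he he' hγ hL hL' ha hac (hcb.trans_lt hbT)
    (hX.mono hac') (fun τ hτ => hXJ τ ⟨hτ.1, hτ.2.trans hcb⟩)
    (fun τ hτ h0 => (hcmin ⟨⟨hτ.1.le, hτ.2.le.trans hcb⟩, h0⟩).not_gt hτ.2)
    (hint.mono_set hac')
  have h2 := hu.le_add_integral_of_loop hN he he' hγ hL hL' (ha.trans hac) hcd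
    (hdb.trans_lt hbT) (hX.mono hcd') (fun τ hτ => hXJ τ ⟨hac.trans hτ.1, hτ.2.trans hdb⟩)
    hXc hXd (hint.mono_set hcd')
  have h3 := hu.le_add_integral_of_ne_zero he he' hγ hL hL' (ha.trans had) hdb hbT
    (hX.mono hdb') (fun τ hτ => hXJ τ ⟨had.trans hτ.1, hτ.2⟩)
    (fun τ hτ h0 => (hdmax ⟨⟨had.trans hτ.1.le, hτ.2.le⟩, h0⟩).not_gt hτ.1)
    (hint.mono_set hdb')
  rw [← intervalIntegral.integral_add_adjacent_intervals
      ((hint.mono_set hac').trans (hint.mono_set hcd')) (hint.mono_set hdb'),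
    ← intervalIntegral.integral_add_adjacent_intervals (hint.mono_set hac') (hint.mono_set hcd')]
  linarith

end Trajectories

end Junction

/-! ### Comparison with the value function. -/

theorem proposition5p2
    {N : ℕ} (hN : 1 ≤ N)
    (e : Fin N → Junction.Plane) (he : ∀ i, ‖e i‖ = 1) (he' : Function.Injective e)
    (L : Fin N → ℝ → ℝ) (γ : ℝ) (hγ : 0 < γ)
    (hL : ∀ i, ContDiff ℝ 2 (L i)) (hL' : ∀ i q, γ ≤ iteratedDeriv 2 (L i) q)
    (u₀ : Junction.Plane → ℝ)
    (hu₀ : ∃ K : ℝ, ∀ x ∈ Junction.junction e, ∀ y ∈ Junction.junction e,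
      |u₀ x - u₀ y| ≤ K * Junction.geodist e x y)
    (T : ℝ) (hT : 0 < T)
    (u : ℝ → Junction.Plane → ℝ)
    (hu : Junction.IsSubsolutionWithInitialData e L T u₀ u)
    (hgrowth : ∃ σ : ℝ, 0 < σ ∧ ∀ t ∈ Set.Ioo 0 T, ∀ x ∈ Junction.junction e,
      u t x ≤ σ * (1 + Junction.geodist e x 0)) :
    ∀ t ∈ Set.Ioo 0 T, ∀ x ∈ Junction.junction e,
      (u t x : EReal) ≤ Junction.valueFunction e L u₀ t x := by 
  intro t ht x hx
  refine le_iInf₂ fun y hy => le_iInf₂ fun X hX => ?_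
  rw [Junction.action]
  split_ifs with hint
  · have hXJ : ∀ τ ∈ Icc 0 t, X τ ∈ Junction.junction e := by
      intro τ hτ
      rcases hτ.1.eq_or_lt with rfl | h0
      · rwa [hX.left]
      rcases hτ.2.eq_or_lt with rfl | h1
      · rwa [hX.right]
      exact hX.mem_junction τ ⟨h0, h1⟩
    have h := hu.toIsSubsolution.le_add_integral hN he he' hγ hL hL' le_rfl ht.1.le ht.2
      hX.absolutelyContinuous hXJ hint
    rw [hX.left, hX.right] at h
    exact_mod_cast h.trans (add_le_add_left (hu.initial y hy) _)
  · simp
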